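/- **Setup.** Distributions are over $[n]=\{1,\dots,n\}$, and $d_{TV}(p,q)=\tfrac12\|p-q\|_1$. A randomized algorithm $A$ that maps a dataset of $s$ samples from $[n]$ to a finite set of outputs is *$\xi$-differentially private* if $\Pr[A(X)\in O]\le e^{\xi}\Pr[A(X')\in O]$ for all datasets $X,X'$ that differ in exactly one sample and every set $O$ of outputs. Let $q$ and $\hat p$ be known distributions over $[n]$. * A *$(\xi,\varepsilon,\delta)$-private identity tester* for $q$ with $s$ samples is a $\xi$-differentially private algorithm with outputs in $\{\mathsf{accept},\mathsf{reject}\}$ that, given $s$ i.i.d. samples from an unknown distribution $p$ over $[n]$, outputs $\mathsf{reject}$ with probability at most $\delta$ if $p=q$, and outputs $\mathsf{accept}$ with probability at most $\delta$ if $d_{TV}(p,q)>\varepsilon$. * A *$(\xi,\varepsilon,\alpha,\delta)$-private augmented identity tester* for $q$ with prediction $\hat p$ and $s$ samples is a $\xi$-differentially private algorithm with outputs in $\{\mathsf{accept},\mathsf{reject},\bot\}$ that, given $s$ i.i.d. samples from an unknown distribution $p$ over $[n]$, outputs $\mathsf{reject}$ with probability at most $\delta$ if $p=q$, outputs $\mathsf{accept}$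 with probability at most $\delta$ if $d_{TV}(p,q)>\varepsilon$, and outputs $\bot$ with probability at most $\delta$ if $d_{TV}(p,\hat p)\le\alpha$. **Theorem.** Let $\varepsilon\in(0,1/2)$, $\alpha\in[0,1/2)$, $\xi>0$, and write $\eta=d_{TV}(q,\hat p)$. 1. (Private augmented identity testing is no easier than private identity testing.) For all distributions $q,\hat p$ over $[n]$ with $\eta<\alpha$ and every $s$: if there is a $(\xi,\varepsilon,\alpha,0.2)$-private augmented identity tester for $q$ with prediction $\hat p$ that takes $s$ samples, then there is a $(\xi,\varepsilon,1/3)$-private identity tester for $q$ that takes $s$ samples. 2. (Lower bound.) There is an absolute constant $c>0$ such that for all $n\ge 2$ and all $\varepsilon,\alpha,\xi$ as above, if $q$ is the uniform distribution over $[n]$ and $\hat p$ is any distribution over $[n]$ with $\eta<\alpha$, then every $(\xi,\varepsilon,\alpha,0.2)$-private augmented identity tester for $q$ with prediction $\hat p$ takes $$ s\;\ge\; c\left(\frac{\sqrt n}{\varepsilon^2}+\frac{n^{1/3}}{\varepsilon^{4/3}\xi^{2/3}}+\frac{\sqrt n}{\varepsilon\sqrt\xi}+\frac1{\varepsilon\xi}\right)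 $$ samples. -/

import Mathlib

namespace PrivateAugmentedTesting

noncomputable section

/-- Total variation distance `(1/2) * ‖p - q‖₁` of two distributions over `[n]`. -/
def tvDist {n : ℕ} (p q : PMF (Fin n)) : ℝ :=
  (1 / 2) * ∑ i, |(p i).toReal - (q i).toReal|

/-- The answers of a standard tester. -/
inductive Answer
  | accept
  | reject

/-- The answers of an augmented tester; `bot` (written `⊥`) means "inaccurate information". -/
inductive AugAnswer
  | accept
  | reject
  | bot

/-- A randomized algorithm on datasets of `s` samples from `[n]` with outputs in `R`:
to each dataset it assigns the distribution of its output. -/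
abbrev Algorithm (n s : ℕ) (R : Type) : Type := (Fin s → Fin n) → PMF R

/-- Pure `ξ`-differential privacy: for any two datasets that differ in exactly one sample and
every set `O` of outputs, `Pr[A(X) ∈ O] ≤ exp ξ * Pr[A(X') ∈ O]`. -/
def IsDP {n s : ℕ} {R : Type} (ξ : ℝ) (A : Algorithm n s R) : Prop :=
  ∀ X X' : Fin s → Fin n, hammingDist X X' = 1 → ∀ O : Set R,
    ((A X).toOuterMeasure O).toReal ≤ Real.exp ξ * ((A X').toOuterMeasure O).toReal

/-- The probability that `A` outputs `r` on `s` independent samples from `p`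
(over the samples and the randomness of `A`). -/
def outputProb {n s : ℕ} {R : Type} (A : Algorithm n s R) (p : PMF (Fin n)) (r : R) : ℝ :=
  ∑ X : Fin s → Fin n, (∏ j, (p (X j)).toReal) * (A X r).toReal

/-- `p` is `ε`-far from the property `P` (a set of distributions). -/
def IsFar {n : ℕ} (ε : ℝ) (p : PMF (Fin n)) (P : Set (PMF (Fin n))) : Prop :=
  ∀ q ∈ P, ε < tvDist p q

/-- `A` is a `(ξ, ε, δ)`-private tester for the property `P`, for an unknown distribution `p`. -/
structure IsPrivateTester {n s : ℕ} (ξ ε δ : ℝ) (P : Set (PMF (Fin n)))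
    (A : Algorithm n s Answer) : Prop where
  dp : IsDP ξ A
  reject_le : ∀ p, p ∈ P → outputProb A p Answer.reject ≤ δ
  accept_le : ∀ p, IsFar ε p P → outputProb A p Answer.accept ≤ δ

/-- `A` is a `(ξ, ε, α, δ)`-private augmented tester for the property `P` with
predicted distribution `phat`, for an unknown distribution `p`. -/
structure IsPrivateAugmentedTester {n s : ℕ} (ξ ε α δ : ℝ) (P : Set (PMF (Fin n)))
    (phat : PMF (Fin n)) (A : Algorithm n s AugAnswer) : Prop where
  dp : IsDP ξ A
  reject_le : ∀ p, p ∈ P → outputProb A p AugAnswer.reject ≤ δ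
  accept_le : ∀ p, IsFar ε p P → outputProb A p AugAnswer.accept ≤ δ
  bot_le : ∀ p, tvDist p phat ≤ α → outputProb A p AugAnswer.bot ≤ δ

/-- Private identity testing to the known distribution `q`: the property is `{q}`. -/
def IsPrivateIdentityTester {n s : ℕ} (ξ ε δ : ℝ) (q : PMF (Fin n))
    (A : Algorithm n s Answer) : Prop :=
  IsPrivateTester ξ ε δ {q} A

/-- Private augmented identity testing to the known distribution `q` with prediction `phat`. -/
def IsPrivateAugmentedIdentityTester {n s : ℕ} (ξ ε α δ : ℝ) (q phat : PMF (Fin n))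
    (A : Algorithm n s AugAnswer) : Prop :=
  IsPrivateAugmentedTester ξ ε α δ {q} phat A

/-- `√n/ε² + n^{1/3}/(ε^{4/3} ξ^{2/3}) + √n/(ε √ξ) + 1/(ε ξ)`. -/
def sampleBound (n : ℕ) (ε ξ : ℝ) : ℝ :=
  √(n : ℝ) / ε ^ 2
    + (n : ℝ) ^ (1 / 3 : ℝ) / (ε ^ (4 / 3 : ℝ) * ξ ^ (2 / 3 : ℝ))
    + √(n : ℝ) / (ε * √ξ)
    + 1 / (ε * ξ)

end

end PrivateAugmentedTesting

namespace PrivateAugmentedTesting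

noncomputable section

/-! Part 1 is post-processing, which preserves privacy. When `p = q`, the distance to `phat` is
below `α`, so both `reject` and `bot` are unlikely. Keeping `accept` and replacing the two other
answers by a biased coin rebalances the errors to `1/3` each.

For part 2, let `f X` be the probability that the tester accepts the dataset `X`. It has mean at
least `3/5` under the uniform distribution, mean at most `1/5` under every far distribution, and by
privacy it changes by at most `exp ξ - 1` when one sample changes. The hard instances cut `[n]` into
blocks of size 2 or 3 and move a fraction `θ`, of order `ε`, of the mass of each block to one of its
points. Averaging over the point gives back the uniform distribution.

The non-private term `√n/ε²` is Ingster's second moment bound for a random choice of all the points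
(`sq_le_of_forall_iidSum_spiked_le`). The term `1/(εξ)` comes from replacing samples one at a time
(`abs_iidSum_sub_le`).

For the two middle terms the points are chosen greedily, block by block (`exists_iidSum_spiked_ge`).
The first-order effect of perturbing a block averages to zero over its points, so some point loses
only a second-order amount: `s` times the Lipschitz constant, times the `ℓ¹` size `O(ε/n)` of the
perturbation, times the `ℓ¹` distance `T` that it causes on fewer than `s` samples. Over at most
`n/2` blocks the loss is `O(s ξ ε T)` for `ξ ≤ 1`, and it must cover the gap `2/5`. Subadditivity
gives `T = O(sε/n)`, hence `√n/(ε√ξ)`; the `χ²` bound gives `T = O(ε√(s/n))`, hence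
`n^{1/3}/(ε^{4/3}ξ^{2/3})`. -/

/-! ### Expectations over independent samples -/

/-- The integral of `f` against the `s`-fold power of the signed weight `p`. -/
def iidSum {ι : Type*} [Fintype ι] {s : ℕ} (p : ι → ℝ) (f : (Fin s → ι) → ℝ) : ℝ :=
  ∑ X : Fin s → ι, (∏ j, p (X j)) * f X

/-- Changing one coordinate changes `f` by at most `L`. -/
def BoundedDiff {ι : Type*} {s : ℕ} (L : ℝ) (f : (Fin s → ι) → ℝ) : Prop :=
  ∀ X j a, |f X - f (Function.update X j a)| ≤ L

lemma BoundedDiff.cons {ι : Type*} {s : ℕ} {L : ℝ} {f : (Fin (s + 1) → ι) → ℝ}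
    (hf : BoundedDiff L f) (x : ι) :
    BoundedDiff L (fun Y => f (Fin.cons x Y)) := by
  intro X j a
  have := hf (Fin.cons x X) j.succ a
  rwa [← Fin.cons_update] at this

lemma BoundedDiff.abs_cons_sub_le {ι : Type*} {s : ℕ} {L : ℝ} {f : (Fin (s + 1) → ι) → ℝ}
    (hf : BoundedDiff L f) (Y : Fin s → ι) (x y : ι) : |f (Fin.cons x Y) - f (Fin.cons y Y)| ≤ L := by
  have := hf (Fin.cons x Y) 0 y
  rwa [Fin.update_cons_zero] at this

section Iid

variable {ι κ : Type*} [Fintype ι] {s : ℕ}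

lemma sum_fin_succ_fun (G : (Fin (s + 1) → ι) → ℝ) :
    ∑ X, G X = ∑ x, ∑ Y : Fin s → ι, G (Fin.cons x Y) := by
  rw [← Fintype.sum_prod_type', ← (Fin.consEquiv (fun _ : Fin (s + 1) => ι)).sum_comp]
  rfl

lemma iidSum_succ (p : ι → ℝ) (f : (Fin (s + 1) → ι) → ℝ) :
    iidSum p f = ∑ x, p x * iidSum p (fun Y => f (Fin.cons x Y)) := by
  simp only [iidSum, sum_fin_succ_fun, Fin.prod_univ_succ, Fin.cons_zero, Fin.cons_succ,
    Finset.mul_sum, mul_assoc]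

lemma sum_prod_eq_one {p : ι → ℝ} (hp : ∑ i, p i = 1) :
    ∑ X : Fin s → ι, ∏ j, p (X j) = 1 := by
  rw [← Fintype.sum_pow, hp, one_pow]

/-- Total mass zero allows a constant to be subtracted from `g`, so only the oscillation of `g`
counts. -/
lemma abs_sum_mul_le_of_sum_eq_zero {ν g : ι → ℝ} {L : ℝ} (hν : ∑ i, ν i = 0)
    (hg : ∀ x y, |g x - g y| ≤ L) : |∑ i, ν i * g i| ≤ L * ∑ i, |ν i| := by
  rcases isEmpty_or_nonempty ι with h | ⟨⟨y⟩⟩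
  · simp
  have : ∑ i, ν i * g i = ∑ i, ν i * (g i - g y) := by
    simp only [mul_sub, Finset.sum_sub_distrib, ← Finset.sum_mul, hν]; ring
  rw [this, Finset.mul_sum]
  refine (Finset.abs_sum_le_sum_abs _ _).trans (Finset.sum_le_sum fun i _ => ?_)
  rw [abs_mul, mul_comm]
  exact mul_le_mul_of_nonneg_right (hg i y) (abs_nonneg _)

/-- Hybrid argument: samples pass from `p` to `p'` one at a time, and each swap integrates a
function of oscillation at most `L` against `p' - p`. -/
lemma abs_iidSum_sub_le {p p' : ι → ℝ} {L : ℝ} (hp : ∀ i, 0 ≤ p i) (hp1 : ∑ i, p i = 1)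
    (hp' : ∀ i, 0 ≤ p' i) (hp1' : ∑ i, p' i = 1) {f : (Fin s → ι) → ℝ} (hf : BoundedDiff L f) :
    |iidSum p' f - iidSum p f| ≤ s * (L * ∑ i, |p' i - p i|) := by
  induction s with
  | zero => simp [iidSum]
  | succ s ih =>
    have key : iidSum p' f - iidSum p f =
        ∑ x, p' x * (iidSum p' (fun Y => f (Fin.cons x Y)) - iidSum p (fun Y => f (Fin.cons x Y)))
        + ∑ Y : Fin s → ι, (∏ j, p (Y j)) * ∑ x, (p' x - p x) * f (Fin.cons x Y) := by
      have : ∑ Y : Fin s → ι, (∏ j, p (Y j)) * ∑ x, (p' x - p x) * f (Fin.cons x Y)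
          = ∑ x, (p' x - p x) * iidSum p (fun Y => f (Fin.cons x Y)) := by
        simp only [iidSum, Finset.mul_sum]
        rw [Finset.sum_comm]
        exact Finset.sum_congr rfl fun _ _ => Finset.sum_congr rfl fun _ _ => by ring
      rw [this, iidSum_succ, iidSum_succ, ← Finset.sum_add_distrib, ← Finset.sum_sub_distrib]
      exact Finset.sum_congr rfl fun _ _ => by ring
    have h1 : |∑ x, p' x * (iidSum p' (fun Y => f (Fin.cons x Y))
        - iidSum p (fun Y => f (Fin.cons x Y)))| ≤ s * (L * ∑ i, |p' i - p i|) := by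
      calc _ ≤ ∑ x, p' x * (s * (L * ∑ i, |p' i - p i|)) := by
            refine (Finset.abs_sum_le_sum_abs _ _).trans (Finset.sum_le_sum fun x _ => ?_)
            rw [abs_mul, abs_of_nonneg (hp' x)]
            exact mul_le_mul_of_nonneg_left (ih (hf.cons x)) (hp' x)
        _ = _ := by rw [← Finset.sum_mul, hp1', one_mul]
    have h2 : |∑ Y : Fin s → ι, (∏ j, p (Y j)) * ∑ x, (p' x - p x) * f (Fin.cons x Y)|
        ≤ L * ∑ i, |p' i - p i| := by
      calc _ ≤ ∑ Y : Fin s → ι, (∏ j, p (Y j)) * (L * ∑ i, |p' i - p i|) := by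
            refine (Finset.abs_sum_le_sum_abs _ _).trans (Finset.sum_le_sum fun Y _ => ?_)
            have h0 : 0 ≤ ∏ j, p (Y j) := Finset.prod_nonneg fun j _ => hp _
            rw [abs_mul, abs_of_nonneg h0]
            refine mul_le_mul_of_nonneg_left (abs_sum_mul_le_of_sum_eq_zero ?_ ?_) h0
            · rw [Finset.sum_sub_distrib, hp1, hp1', sub_self]
            · exact hf.abs_cons_sub_le Y
        _ = _ := by rw [← Finset.sum_mul, sum_prod_eq_one hp1, one_mul]
    rw [key]
    push_cast
    linarith [abs_add_le (∑ x, p' x * (iidSum p' (fun Y => f (Fin.cons x Y))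
        - iidSum p (fun Y => f (Fin.cons x Y))))
      (∑ Y : Fin s → ι, (∏ j, p (Y j)) * ∑ x, (p' x - p x) * f (Fin.cons x Y))]

/-- Subadditivity of the `ℓ¹` distance between product distributions. -/
lemma sum_abs_prod_sub_prod_le {p p' : ι → ℝ} (hp : ∀ i, 0 ≤ p i) (hp1 : ∑ i, p i = 1)
    (hp' : ∀ i, 0 ≤ p' i) (hp1' : ∑ i, p' i = 1) (s : ℕ) :
    ∑ X : Fin s → ι, |∏ j, p' (X j) - ∏ j, p (X j)| ≤ s * ∑ i, |p' i - p i| := by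
  induction s with
  | zero => simp
  | succ s ih =>
    rw [sum_fin_succ_fun]
    simp only [Fin.prod_univ_succ, Fin.cons_zero, Fin.cons_succ]
    calc _ ≤ ∑ x, ∑ Y : Fin s → ι, (p' x * |∏ j, p' (Y j) - ∏ j, p (Y j)|
            + |p' x - p x| * ∏ j, p (Y j)) := by
          refine Finset.sum_le_sum fun x _ => Finset.sum_le_sum fun Y _ => ?_
          have h0 : 0 ≤ ∏ j, p (Y j) := Finset.prod_nonneg fun j _ => hp _
          have e : p' x * ∏ j, p' (Y j) - p x * ∏ j, p (Y j) =
            p' x * (∏ j, p' (Y j) - ∏ j, p (Y j)) + (p' x - p x) * ∏ j, p (Y j) := by ring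
          rw [e]
          refine (abs_add_le _ _).trans ?_
          rw [abs_mul, abs_mul, abs_of_nonneg h0, abs_of_nonneg (hp' x)]
      _ = ∑ Y : Fin s → ι, |∏ j, p' (Y j) - ∏ j, p (Y j)| + ∑ i, |p' i - p i| := by
          simp only [Finset.sum_add_distrib, ← Finset.mul_sum, ← Finset.sum_mul, hp1',
            sum_prod_eq_one hp1, one_mul, mul_one]
      _ ≤ _ := by push_cast; linarith

lemma sum_abs_prod_sub_prod_le_two {p p' : ι → ℝ} (hp : ∀ i, 0 ≤ p i) (hp1 : ∑ i, p i = 1)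
    (hp' : ∀ i, 0 ≤ p' i) (hp1' : ∑ i, p' i = 1) (s : ℕ) :
    ∑ X : Fin s → ι, |∏ j, p' (X j) - ∏ j, p (X j)| ≤ 2 := by
  calc _ ≤ ∑ X : Fin s → ι, (∏ j, p' (X j) + ∏ j, p (X j)) := by
        refine Finset.sum_le_sum fun X _ => ?_
        have h0 : 0 ≤ ∏ j, p (X j) := Finset.prod_nonneg fun j _ => hp _
        have h0' : 0 ≤ ∏ j, p' (X j) := Finset.prod_nonneg fun j _ => hp' _
        rw [abs_le]; constructor <;> linarith
    _ = 2 := by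
        rw [Finset.sum_add_distrib, sum_prod_eq_one hp1, sum_prod_eq_one hp1']; norm_num

/-- The `χ²` bound on the `ℓ¹` distance between a mixture of product distributions and a product
distribution. -/
lemma sq_sum_abs_mixture_sub_le {p : ι → ℝ} (hp : ∀ i, 0 ≤ p i) (hp1 : ∑ i, p i = 1)
    (P : Finset κ) (hP : P.Nonempty) (u : κ → ι → ℝ) (hu : ∀ r ∈ P, ∑ i, p i * u r i = 0)
    (s : ℕ) :
    (∑ X : Fin s → ι, |(P.card : ℝ)⁻¹ * ∑ r ∈ P, ∏ j, (p (X j) * (1 + u r (X j)))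
      - ∏ j, p (X j)|) ^ 2 ≤
    ((P.card : ℝ)⁻¹) ^ 2 * ∑ r ∈ P, ∑ r' ∈ P, (1 + ∑ i, p i * (u r i * u r' i)) ^ s - 1 := by
  have hc : (P.card : ℝ) ≠ 0 := by simpa using hP.ne_empty
  set N : ℝ := (P.card : ℝ)⁻¹ with hN
  have hNc : N * P.card = 1 := inv_mul_cancel₀ hc
  set W : (Fin s → ι) → ℝ := fun X => ∏ j, p (X j) with hW
  have hW0 : ∀ X, 0 ≤ W X := fun X => Finset.prod_nonneg fun j _ => hp _
  have hW1 : ∑ X, W X = 1 := sum_prod_eq_one hp1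
  set Q : κ → (Fin s → ι) → ℝ := fun r X => ∏ j, (1 + u r (X j)) with hQ
  have hWQ : ∀ r ∈ P, ∑ X, W X * Q r X = 1 := by
    intro r hr
    simp only [hW, hQ, ← Finset.prod_mul_distrib]
    refine sum_prod_eq_one (p := fun i => p i * (1 + u r i)) ?_
    simp only [mul_add, mul_one, Finset.sum_add_distrib, hp1, hu r hr, add_zero]
  -- Second moments of the likelihood ratios tensorize, and the terms linear in `u` vanish by
  -- centring.
  have hWQQ : ∀ r ∈ P, ∀ r' ∈ P, ∑ X, W X * (Q r X * Q r' X)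
      = (1 + ∑ i, p i * (u r i * u r' i)) ^ s := by
    intro r hr r' hr'
    simp only [hW, hQ, ← Finset.prod_mul_distrib]
    rw [← Fintype.sum_pow (fun i => p i * ((1 + u r i) * (1 + u r' i)))]
    congr 1
    have : ∀ i, p i * ((1 + u r i) * (1 + u r' i)) =
      p i + p i * u r i + p i * u r' i + p i * (u r i * u r' i) := fun i => by ring
    simp only [this, Finset.sum_add_distrib, hp1, hu r hr, hu r' hr', add_zero]
  have e1 : ∀ X, |N * ∑ r ∈ P, ∏ j, (p (X j) * (1 + u r (X j))) - ∏ j, p (X j)|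
      = W X * |N * ∑ r ∈ P, Q r X - 1| := by
    intro X
    have : N * ∑ r ∈ P, ∏ j, (p (X j) * (1 + u r (X j))) - ∏ j, p (X j)
        = W X * (N * ∑ r ∈ P, Q r X - 1) := by
      simp only [Finset.prod_mul_distrib, ← Finset.mul_sum, hW, hQ]
      ring
    rw [this, abs_mul, abs_of_nonneg (hW0 X)]
  simp only [e1]
  have cs : (∑ X, W X * |N * ∑ r ∈ P, Q r X - 1|) ^ 2 ≤
      (∑ X, W X) * ∑ X, W X * (N * ∑ r ∈ P, Q r X - 1) ^ 2 := by
    refine Finset.sum_sq_le_sum_mul_sum_of_sq_le_mul _ (fun X _ => hW0 X)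
      (fun X _ => mul_nonneg (hW0 X) (sq_nonneg _)) (fun X _ => ?_)
    rw [mul_pow, sq_abs]; exact le_of_eq (by ring)
  refine cs.trans (le_of_eq ?_)
  rw [hW1, one_mul]
  have e2 : ∀ X, W X * (N * ∑ r ∈ P, Q r X - 1) ^ 2 =
      N ^ 2 * (∑ r ∈ P, ∑ r' ∈ P, W X * (Q r X * Q r' X)) - 2 * N * (∑ r ∈ P, W X * Q r X)
        + W X := by
    intro X
    have : ∑ r ∈ P, ∑ r' ∈ P, W X * (Q r X * Q r' X)
        = W X * ((∑ r ∈ P, Q r X) * ∑ r ∈ P, Q r X) := by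
      rw [Finset.sum_mul_sum]; simp only [Finset.mul_sum]
    rw [this, ← Finset.mul_sum]; ring
  have e3 : ∑ X, ∑ r ∈ P, W X * Q r X = P.card := by
    rw [Finset.sum_comm, Finset.sum_congr rfl hWQ]; simp
  have e4 : ∑ X, ∑ r ∈ P, ∑ r' ∈ P, W X * (Q r X * Q r' X)
      = ∑ r ∈ P, ∑ r' ∈ P, (1 + ∑ i, p i * (u r i * u r' i)) ^ s := by
    rw [Finset.sum_comm]
    refine Finset.sum_congr rfl fun r hr => ?_
    rw [Finset.sum_comm]
    exact Finset.sum_congr rfl fun r' hr' => hWQQ r hr r' hr'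
  rw [Finset.sum_congr rfl fun X _ => e2 X, Finset.sum_add_distrib, Finset.sum_sub_distrib,
    ← Finset.mul_sum, ← Finset.mul_sum, e3, e4, hW1]
  linear_combination (-2) * hNc

/-- The `χ²` bound on the `ℓ¹` distance between two product distributions. -/
lemma sum_abs_prod_tilt_sub_prod_le {p u : ι → ℝ} (hp : ∀ i, 0 ≤ p i) (hp1 : ∑ i, p i = 1)
    (hu : ∑ i, p i * u i = 0) (hu1 : ∀ i, -1 ≤ u i) (s : ℕ) :
    ∑ X : Fin s → ι, |∏ j, (p (X j) * (1 + u (X j))) - ∏ j, p (X j)| ≤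
      2 * √(s * ∑ i, p i * u i ^ 2) := by
  set C := ∑ i, p i * u i ^ 2 with hC
  have hC0 : 0 ≤ C := Finset.sum_nonneg fun i _ => mul_nonneg (hp i) (sq_nonneg _)
  have hsC : 0 ≤ s * C := by positivity
  -- If `s * C ≥ 1` the trivial bound 2 is enough. Otherwise the mixture bound is used with a single
  -- component, and `exp x - 1 ≤ x + x² ≤ 4x` for `x = s * C ≤ 1`.
  by_cases h : 1 ≤ s * C
  · have h1 : 1 ≤ √(s * C) := Real.one_le_sqrt.2 h
    refine (sum_abs_prod_sub_prod_le_two (p' := fun i => p i * (1 + u i)) hp hp1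
      (fun i => mul_nonneg (hp i) (by linarith [hu1 i])) ?_ s).trans (by linarith)
    simp only [mul_add, mul_one, Finset.sum_add_distrib, hp1, hu, add_zero]
  · push Not at h
    have key := sq_sum_abs_mixture_sub_le hp hp1 {()} (by simp) (fun _ => u) (by simpa using hu) s
    simp only [Finset.card_singleton, Nat.cast_one, inv_one, one_pow, one_mul,
      Finset.sum_singleton, ← pow_two] at key
    rw [← hC] at key
    have h2 : (1 + C) ^ s ≤ Real.exp (s * C) := by
      rw [Real.exp_nat_mul]
      exact pow_le_pow_left₀ (by linarith) (by linarith [Real.add_one_le_exp C]) s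
    have h3 := (abs_le.1 (Real.abs_exp_sub_one_sub_id_le (x := s * C)
      (by rw [abs_of_nonneg hsC]; exact h.le))).2
    refine abs_le_of_sq_le_sq' ?_ (by positivity) |>.2
    rw [mul_pow, Real.sq_sqrt hsC]
    nlinarith

/-- Averaging over centred perturbations of one factor moves the expectation of a function of
bounded differences only to second order. -/
lemma abs_sum_iidSum_add_sub_le {p : ι → ℝ} (hp : ∀ i, 0 ≤ p i) (hp1 : ∑ i, p i = 1)
    (R : Finset κ) (ν : κ → ι → ℝ) (hR : ∀ i, ∑ r ∈ R, ν r i = 0)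
    (hν : ∀ r ∈ R, ∑ i, ν r i = 0) {L K T : ℝ} (hL : 0 ≤ L) (hK : ∀ r ∈ R, ∑ i, |ν r i| ≤ K)
    {f : (Fin s → ι) → ℝ}
    (hT : ∀ r ∈ R, ∀ t < s, ∑ Y : Fin t → ι, |∏ j, (p (Y j) + ν r (Y j)) - ∏ j, p (Y j)| ≤ T)
    (hf : BoundedDiff L f) :
    |∑ r ∈ R, (iidSum (fun i => p i + ν r i) f - iidSum p f)| ≤ R.card * (s * (L * K * T)) := by
  induction s with
  | zero => simp [iidSum]
  | succ s ih =>
    -- The first sample is split as `p + ν r`. The `p` part is the induction hypothesis; in the `ν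
    -- r` part the other samples may be compared with their law under `p`, because the term
    -- subtracted for this vanishes after summing over `r` (`e2`). This is where the first-order
    -- effect cancels.
    have key : ∑ r ∈ R, (iidSum (fun i => p i + ν r i) f - iidSum p f) =
        ∑ x, p x * ∑ r ∈ R, (iidSum (fun i => p i + ν r i) (fun Y => f (Fin.cons x Y))
            - iidSum p (fun Y => f (Fin.cons x Y)))
        + ∑ r ∈ R, ∑ Y : Fin s → ι, (∏ j, (p (Y j) + ν r (Y j)) - ∏ j, p (Y j))
            * ∑ x, ν r x * f (Fin.cons x Y) := by
      have e1 : ∀ r, ∑ Y : Fin s → ι, (∏ j, (p (Y j) + ν r (Y j)) - ∏ j, p (Y j))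
            * ∑ x, ν r x * f (Fin.cons x Y)
          = ∑ x, ν r x * (iidSum (fun i => p i + ν r i) (fun Y => f (Fin.cons x Y))
            - iidSum p (fun Y => f (Fin.cons x Y))) := by
        intro r
        simp only [iidSum, Finset.mul_sum, ← Finset.sum_sub_distrib]
        rw [Finset.sum_comm]
        exact Finset.sum_congr rfl fun _ _ => Finset.sum_congr rfl fun _ _ => by ring
      have e2 : ∑ r ∈ R, ∑ x, ν r x * iidSum p (fun Y => f (Fin.cons x Y)) = 0 := by
        rw [Finset.sum_comm]
        simp only [← Finset.sum_mul, hR, zero_mul, Finset.sum_const_zero]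
      have e3 : ∀ r, iidSum (fun i => p i + ν r i) f - iidSum p f =
          ∑ x, p x * (iidSum (fun i => p i + ν r i) (fun Y => f (Fin.cons x Y))
            - iidSum p (fun Y => f (Fin.cons x Y)))
          + (∑ x, ν r x * (iidSum (fun i => p i + ν r i) (fun Y => f (Fin.cons x Y))
            - iidSum p (fun Y => f (Fin.cons x Y)))
          + ∑ x, ν r x * iidSum p (fun Y => f (Fin.cons x Y))) := by
        intro r
        rw [iidSum_succ, iidSum_succ, ← Finset.sum_add_distrib, ← Finset.sum_add_distrib,
          ← Finset.sum_sub_distrib]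
        exact Finset.sum_congr rfl fun _ _ => by ring
      rw [Finset.sum_congr rfl fun r _ => e3 r, Finset.sum_add_distrib, Finset.sum_add_distrib,
        e2, add_zero, Finset.sum_congr rfl fun r _ => e1 r, Finset.sum_comm]
      simp only [Finset.mul_sum]
    have h1 : |∑ x, p x * ∑ r ∈ R, (iidSum (fun i => p i + ν r i) (fun Y => f (Fin.cons x Y))
            - iidSum p (fun Y => f (Fin.cons x Y)))| ≤ R.card * (s * (L * K * T)) := by
      calc _ ≤ ∑ x, p x * (R.card * (s * (L * K * T))) := by
            refine (Finset.abs_sum_le_sum_abs _ _).trans (Finset.sum_le_sum fun x _ => ?_)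
            rw [abs_mul, abs_of_nonneg (hp x)]
            exact mul_le_mul_of_nonneg_left
              (ih (fun r hr t ht => hT r hr t (by omega)) (hf.cons x)) (hp x)
        _ = _ := by rw [← Finset.sum_mul, hp1, one_mul]
    have h2 : |∑ r ∈ R, ∑ Y : Fin s → ι, (∏ j, (p (Y j) + ν r (Y j)) - ∏ j, p (Y j))
            * ∑ x, ν r x * f (Fin.cons x Y)| ≤ R.card * (L * K * T) := by
      rw [← nsmul_eq_mul]
      refine (Finset.abs_sum_le_sum_abs _ _).trans (Finset.sum_le_card_nsmul _ _ _ fun r hr => ?_)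
      have hK0 : 0 ≤ K := (Finset.sum_nonneg fun i _ => abs_nonneg _).trans (hK r hr)
      calc _ ≤ ∑ Y : Fin s → ι, |∏ j, (p (Y j) + ν r (Y j)) - ∏ j, p (Y j)| * (L * K) := by
            refine (Finset.abs_sum_le_sum_abs _ _).trans (Finset.sum_le_sum fun Y _ => ?_)
            rw [abs_mul]
            refine mul_le_mul_of_nonneg_left ?_ (abs_nonneg _)
            exact (abs_sum_mul_le_of_sum_eq_zero (hν r hr) (hf.abs_cons_sub_le Y)).trans
              (mul_le_mul_of_nonneg_left (hK r hr) hL)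
        _ ≤ T * (L * K) := by
            rw [← Finset.sum_mul]
            exact mul_le_mul_of_nonneg_right (hT r hr s (by omega)) (mul_nonneg hL hK0)
        _ = _ := by ring
    rw [key]
    refine (abs_add_le _ _).trans ((add_le_add h1 h2).trans (le_of_eq ?_))
    push_cast
    ring

end Iid

/-! ### Concentrating the mass of each block of a partition on one of its points -/

section Blocks

variable {n m : ℕ}

/-- The fibre of `b` over `k`. -/
def block (b : Fin n → Fin m) (k : Fin m) : Finset (Fin n) := {i | b i = k}

/-- The density, relative to the uniform distribution, of moving all the mass of block `k` to its
point `r`, minus one. -/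
def bump (b : Fin n → Fin m) (k : Fin m) (r i : Fin n) : ℝ :=
  if b i = k then (if i = r then ((block b k).card : ℝ) else 0) - 1 else 0

/-- The perturbation of the uniform distribution that moves a `θ`-fraction of the mass of each block
`k ∈ S` to the point `ρ k`. -/
def spiked (b : Fin n → Fin m) (θ : ℝ) (S : Finset (Fin m)) (ρ : Fin m → Fin n) (i : Fin n) : ℝ :=
  (n : ℝ)⁻¹ * (1 + θ * ∑ k ∈ S, bump b k (ρ k) i)

variable {b : Fin n → Fin m} {k : Fin m} {r r' : Fin n}

lemma mem_block {i : Fin n} : i ∈ block b k ↔ b i = k := by simp [block]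

lemma sum_bump_mul_bump (hr : b r = k) (hr' : b r' = k) :
    ∑ i, bump b k r i * bump b k r' i =
      (block b k).card * ((if r = r' then ((block b k).card : ℝ) else 0) - 1) := by
  have : ∀ i, bump b k r i * bump b k r' i = if i ∈ block b k then
      (if i = r then (if i = r' then ((block b k).card : ℝ) ^ 2 else 0) else 0)
      - (if i = r then ((block b k).card : ℝ) else 0)
      - (if i = r' then ((block b k).card : ℝ) else 0) + 1 else 0 := by
    intro i
    simp only [bump, mem_block]
    split_ifs <;> ring
  rw [Finset.sum_congr rfl fun i _ => this i]
  simp only [Finset.sum_ite_mem, Finset.univ_inter]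
  simp only [Finset.sum_add_distrib, Finset.sum_sub_distrib, Finset.sum_ite_eq', mem_block, hr,
    if_true, hr', Finset.sum_const, nsmul_eq_mul]
  split_ifs <;> ring

lemma sum_bump (hr : b r = k) : ∑ i, bump b k r i = 0 := by
  have : ∀ i, bump b k r i = if i ∈ block b k then
      (if i = r then ((block b k).card : ℝ) else 0) - 1 else 0 := by
    intro i; simp only [bump, mem_block]
  rw [Finset.sum_congr rfl fun i _ => this i]
  simp only [Finset.sum_ite_mem, Finset.univ_inter]
  simp [mem_block, hr]

/-- This is the centring that the second-order estimate requires. -/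
lemma sum_bump_block (k : Fin m) (i : Fin n) : ∑ r ∈ block b k, bump b k r i = 0 := by
  by_cases h : b i = k
  · simp [bump, h, Finset.sum_sub_distrib, mem_block]
  · simp [bump, h]

lemma card_block_pos (hr : b r = k) : 1 ≤ (block b k).card :=
  Finset.card_pos.2 ⟨r, mem_block.2 hr⟩

lemma sum_abs_bump (hr : b r = k) :
    ∑ i, |bump b k r i| = 2 * ((block b k).card - 1) := by
  have hc : (1 : ℝ) ≤ (block b k).card := by exact_mod_cast card_block_pos hr
  have : ∀ i, |bump b k r i| = if i ∈ block b k then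
      (if i = r then ((block b k).card : ℝ) - 2 else 0) + 1 else 0 := by
    intro i
    simp only [bump, mem_block]
    split_ifs
    · rw [abs_of_nonneg (by linarith)]; ring
    · norm_num
    · simp
  rw [Finset.sum_congr rfl fun i _ => this i]
  simp only [Finset.sum_ite_mem, Finset.univ_inter]
  simp only [Finset.sum_add_distrib, Finset.sum_ite_eq', mem_block, hr, if_true, Finset.sum_const,
    nsmul_eq_mul]
  ring

lemma neg_one_le_bump (i : Fin n) : -1 ≤ bump b k r i := by
  unfold bump
  have : (0 : ℝ) ≤ (block b k).card := Nat.cast_nonneg _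
  split_ifs <;> linarith

/-- Blocks are disjoint, so perturbations of different blocks never accumulate at a point; densities
stay nonnegative for `θ ≤ 1` however many blocks are perturbed. -/
lemma sum_bump_eq (S : Finset (Fin m)) (ρ : Fin m → Fin n) (i : Fin n) :
    ∑ k ∈ S, bump b k (ρ k) i = if b i ∈ S then bump b (b i) (ρ (b i)) i else 0 := by
  simp only [bump, Finset.sum_ite_eq, if_true]

lemma neg_one_le_sum_bump (S : Finset (Fin m)) (ρ : Fin m → Fin n) (i : Fin n) :
    -1 ≤ ∑ k ∈ S, bump b k (ρ k) i := by
  rw [sum_bump_eq]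
  split_ifs
  · exact neg_one_le_bump i
  · norm_num

lemma abs_sum_bump (ρ : Fin m → Fin n) (i : Fin n) :
    |∑ k, bump b k (ρ k) i| = ∑ k, |bump b k (ρ k) i| := by
  rw [sum_bump_eq, Finset.sum_eq_single (b i)]
  · simp
  · intro k _ hk; simp [bump, hk.symm]
  · simp

lemma sum_bump_mul_sum_bump (ρ ρ' : Fin m → Fin n) (i : Fin n) :
    (∑ k, bump b k (ρ k) i) * ∑ k, bump b k (ρ' k) i
      = ∑ k, bump b k (ρ k) i * bump b k (ρ' k) i := by
  rw [sum_bump_eq, sum_bump_eq, Finset.sum_eq_single (b i)]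
  · simp
  · intro k _ hk; simp [bump, hk.symm]
  · simp

/-! ### Spiked distributions: mass, distance to uniform, cost of one more block. -/

variable {θ : ℝ} {ρ : Fin m → Fin n}

lemma spiked_nonneg (hθ : 0 ≤ θ) (hθ1 : θ ≤ 1) (S : Finset (Fin m)) (i : Fin n) :
    0 ≤ spiked b θ S ρ i := by
  refine mul_nonneg (by positivity) ?_
  nlinarith [neg_one_le_sum_bump (b := b) S ρ i]

lemma sum_spiked (hn : 0 < n) (S : Finset (Fin m)) (hρ : ∀ k, b (ρ k) = k) :
    ∑ i, spiked b θ S ρ i = 1 := by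
  have hn' : (n : ℝ) ≠ 0 := by positivity
  simp only [spiked, ← Finset.mul_sum, Finset.sum_add_distrib]
  rw [Finset.sum_comm, Finset.sum_eq_zero fun k _ => sum_bump (hρ k)]
  simp [hn']

lemma spiked_insert {S : Finset (Fin m)} (hk : k ∉ S) (i : Fin n) :
    spiked b θ (insert k S) (Function.update ρ k r) i
      = spiked b θ S ρ i + (n : ℝ)⁻¹ * (θ * bump b k r i) := by
  have : ∑ j ∈ S, bump b j (Function.update ρ k r j) i = ∑ j ∈ S, bump b j (ρ j) i :=
    Finset.sum_congr rfl fun j hj => by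
      rw [Function.update_of_ne (ne_of_mem_of_not_mem hj hk)]
  simp only [spiked, Finset.sum_insert hk, Function.update_self, this]
  ring

/-- A block not yet treated still carries the uniform weight, so the additive perturbation of that
block is also a multiplicative tilt by `1 + θ * bump`, as the `χ²` bound needs. -/
lemma spiked_mul_bump {S : Finset (Fin m)} (hk : k ∉ S) (i : Fin n) :
    spiked b θ S ρ i * bump b k r i = (n : ℝ)⁻¹ * bump b k r i := by
  by_cases h : b i = k
  · rw [spiked, sum_bump_eq, if_neg (h ▸ hk)]; ring
  · simp [bump, h]

lemma sum_card_block (b : Fin n → Fin m) : ∑ k, ((block b k).card : ℝ) = n := by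
  have := Finset.card_eq_sum_card_fiberwise (f := b) (s := Finset.univ) (t := Finset.univ)
    (by simp)
  rw [Finset.card_univ, Fintype.card_fin] at this
  exact_mod_cast this.symm

lemma two_mul_le (hb : ∀ k, 2 ≤ (block b k).card ∧ (block b k).card ≤ 3) : (2 * m : ℝ) ≤ n := by
  rw [← sum_card_block b]
  calc (2 * m : ℝ) = ∑ k : Fin m, 2 := by simp [mul_comm]
    _ ≤ _ := Finset.sum_le_sum fun k _ => by exact_mod_cast (hb k).1

lemma sum_abs_spiked_sub (hθ : 0 ≤ θ) (hρ : ∀ k, b (ρ k) = k) :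
    ∑ i, |spiked b θ Finset.univ ρ i - (n : ℝ)⁻¹|
      = (n : ℝ)⁻¹ * θ * ∑ k, 2 * (((block b k).card : ℝ) - 1) := by
  have : ∀ i, |spiked b θ Finset.univ ρ i - (n : ℝ)⁻¹|
      = (n : ℝ)⁻¹ * θ * ∑ k, |bump b k (ρ k) i| := by
    intro i
    have e : spiked b θ Finset.univ ρ i - (n : ℝ)⁻¹ = ((n : ℝ)⁻¹ * θ) * ∑ k, bump b k (ρ k) i := by
      unfold spiked; ring
    rw [e, abs_mul, abs_sum_bump, abs_of_nonneg (by positivity)]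
  simp only [this, ← Finset.mul_sum]
  rw [Finset.sum_comm]
  simp only [sum_abs_bump (hρ _), Finset.mul_sum]

/-- A block of size `c` contributes `2(c - 1)θ/n`, and `2(c - 1) ≥ c` once `c ≥ 2`. -/
lemma le_sum_abs_spiked_sub (hn : 0 < n) (hθ : 0 ≤ θ)
    (hb : ∀ k, 2 ≤ (block b k).card ∧ (block b k).card ≤ 3) (hρ : ∀ k, b (ρ k) = k) :
    θ ≤ ∑ i, |spiked b θ Finset.univ ρ i - (n : ℝ)⁻¹| := by
  have hn' : (n : ℝ) ≠ 0 := by positivity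
  rw [sum_abs_spiked_sub hθ hρ]
  have : (n : ℝ) ≤ ∑ k, 2 * (((block b k).card : ℝ) - 1) := by
    conv_lhs => rw [← sum_card_block b]
    refine Finset.sum_le_sum fun k _ => ?_
    have : (2 : ℝ) ≤ (block b k).card := by exact_mod_cast (hb k).1
    linarith
  calc θ = (n : ℝ)⁻¹ * θ * n := by field_simp
    _ ≤ _ := mul_le_mul_of_nonneg_left this (by positivity)

lemma sum_abs_spiked_sub_le (hn : 0 < n) (hθ : 0 ≤ θ) (hρ : ∀ k, b (ρ k) = k) :
    ∑ i, |spiked b θ Finset.univ ρ i - (n : ℝ)⁻¹| ≤ 2 * θ := by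
  have hn' : (n : ℝ) ≠ 0 := by positivity
  rw [sum_abs_spiked_sub hθ hρ]
  have : ∑ k, 2 * (((block b k).card : ℝ) - 1) ≤ 2 * n := by
    conv_rhs => rw [← sum_card_block b, Finset.mul_sum]
    exact Finset.sum_le_sum fun k _ => by linarith
  calc _ ≤ (n : ℝ)⁻¹ * θ * (2 * n) := mul_le_mul_of_nonneg_left this (by positivity)
    _ = _ := by field_simp

lemma sum_abs_scaled_bump_le (hn : 0 < n) (hθ : 0 ≤ θ) (hb : (block b k).card ≤ 3) (hr : b r = k) :
    ∑ i, |(n : ℝ)⁻¹ * (θ * bump b k r i)| ≤ 4 * θ / n := by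
  have hn0 : (0 : ℝ) < n := by positivity
  have hc3 : ((block b k).card : ℝ) ≤ 3 := by exact_mod_cast hb
  have : ∀ i, |(n : ℝ)⁻¹ * (θ * bump b k r i)| = (n : ℝ)⁻¹ * θ * |bump b k r i| := by
    intro i
    rw [← mul_assoc, abs_mul, abs_of_nonneg (by positivity)]
  rw [Finset.sum_congr rfl fun i _ => this i, ← Finset.mul_sum, sum_abs_bump hr]
  calc _ ≤ (n : ℝ)⁻¹ * θ * 4 := mul_le_mul_of_nonneg_left (by linarith) (by positivity)
    _ = _ := by field_simp

/-- Perturbing a block of size `c` has `χ²` cost `θ² c(c - 1)/n` per sample, and `c(c - 1) ≤ 6` for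
`c ≤ 3`. -/
lemma sum_abs_prod_spiked_le (hn : 0 < n) (hθ : 0 ≤ θ) (hθ1 : θ ≤ 1)
    (hb : (block b k).card ≤ 3) {S : Finset (Fin m)} (hk : k ∉ S) (hρ : ∀ k, b (ρ k) = k)
    (hr : b r = k) (t : ℕ) :
    ∑ Y : Fin t → Fin n, |∏ j, (spiked b θ S ρ (Y j) + (n : ℝ)⁻¹ * (θ * bump b k r (Y j)))
      - ∏ j, spiked b θ S ρ (Y j)| ≤ 2 * √(t * (6 * θ ^ 2 / n)) := by
  have hn0 : (0 : ℝ) < n := by positivity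
  have hc3 : ((block b k).card : ℝ) ≤ 3 := by exact_mod_cast hb
  have hc1 : (1 : ℝ) ≤ (block b k).card := by exact_mod_cast card_block_pos hr
  have hp0 : ∀ i, 0 ≤ spiked b θ S ρ i := fun i => spiked_nonneg hθ hθ1 S i
  have e' : ∀ i, spiked b θ S ρ i * (θ * bump b k r i) = (n : ℝ)⁻¹ * (θ * bump b k r i) := by
    intro i
    linear_combination θ * spiked_mul_bump (θ := θ) (ρ := ρ) (r := r) hk i
  have e : ∀ i, spiked b θ S ρ i + (n : ℝ)⁻¹ * (θ * bump b k r i)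
      = spiked b θ S ρ i * (1 + θ * bump b k r i) := by
    intro i; linear_combination -e' i
  simp only [e]
  refine (sum_abs_prod_tilt_sub_prod_le (u := fun i => θ * bump b k r i) hp0
    (sum_spiked hn S hρ) ?_ ?_ t).trans ?_
  · rw [Finset.sum_congr rfl fun i _ => e' i, ← Finset.mul_sum, ← Finset.mul_sum, sum_bump hr]
    ring
  · intro i; nlinarith [neg_one_le_bump (b := b) (k := k) (r := r) i]
  · have : ∑ i, spiked b θ S ρ i * (θ * bump b k r i) ^ 2 ≤ 6 * θ ^ 2 / n := by
      calc _ = (n : ℝ)⁻¹ * θ ^ 2 * ∑ i, bump b k r i * bump b k r i := by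
            rw [Finset.mul_sum]
            refine Finset.sum_congr rfl fun i _ => ?_
            rw [pow_two, ← mul_assoc, e' i]
            ring
        _ ≤ (n : ℝ)⁻¹ * θ ^ 2 * 6 := by
            refine mul_le_mul_of_nonneg_left ?_ (by positivity)
            rw [sum_bump_mul_bump hr hr, if_pos rfl]
            nlinarith
        _ = _ := by field_simp
    exact mul_le_mul_of_nonneg_left
      (Real.sqrt_le_sqrt (mul_le_mul_of_nonneg_left this (Nat.cast_nonneg _))) two_pos.le

/-- For a function of bounded differences, the points on which the blocks are concentrated can be
chosen one after the other, at a second-order loss each. -/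
lemma exists_iidSum_spiked_ge (hn : 0 < n) (hθ : 0 ≤ θ) (hθ1 : θ ≤ 1)
    (hb : ∀ k, 2 ≤ (block b k).card ∧ (block b k).card ≤ 3) {s : ℕ} {f : (Fin s → Fin n) → ℝ}
    {L T : ℝ} (hL : 0 ≤ L) (hf : BoundedDiff L f)
    (hT : s * (4 * θ / n) ≤ T ∨ 2 * √(s * (6 * θ ^ 2 / n)) ≤ T) (S : Finset (Fin m)) :
    ∃ ρ : Fin m → Fin n, (∀ k, b (ρ k) = k) ∧
      iidSum (fun _ => (n : ℝ)⁻¹) f - S.card * (s * (L * (4 * θ / n) * T))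
        ≤ iidSum (spiked b θ S ρ) f := by
  have hne : ∀ k, (block b k).Nonempty := fun k =>
    Finset.card_pos.1 (lt_of_lt_of_le two_pos (hb k).1)
  induction S using Finset.induction_on with
  | empty =>
    choose ρ hρ using hne
    refine ⟨ρ, fun k => mem_block.1 (hρ k), ?_⟩
    have : spiked b θ ∅ ρ = fun _ => (n : ℝ)⁻¹ := by ext i; simp [spiked]
    simp [this]
  | insert k S hk ih =>
    obtain ⟨ρ, hρ, h⟩ := ih
    have hp0 : ∀ i, 0 ≤ spiked b θ S ρ i := fun i => spiked_nonneg hθ hθ1 S i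
    have hp1 : ∑ i, spiked b θ S ρ i = 1 := sum_spiked hn S hρ
    have hρ' : ∀ r ∈ block b k, ∀ j, b (Function.update ρ k r j) = j := by
      intro r hr j
      by_cases hj : j = k
      · subst hj; simpa using mem_block.1 hr
      · rw [Function.update_of_ne hj, hρ]
    have hins : ∀ r, (fun i => spiked b θ S ρ i + (n : ℝ)⁻¹ * (θ * bump b k r i))
        = spiked b θ (insert k S) (Function.update ρ k r) := by
      intro r; ext i; rw [spiked_insert hk]
    have hνK : ∀ r ∈ block b k, ∑ i, |(n : ℝ)⁻¹ * (θ * bump b k r i)| ≤ 4 * θ / n :=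
      fun r hr => sum_abs_scaled_bump_le hn hθ (hb k).2 (mem_block.1 hr)
    have hTV : ∀ r ∈ block b k, ∀ t < s,
        ∑ Y : Fin t → Fin n, |∏ j, (spiked b θ S ρ (Y j) + (n : ℝ)⁻¹ * (θ * bump b k r (Y j)))
          - ∏ j, spiked b θ S ρ (Y j)| ≤ T := by
      intro r hr t ht
      have hts : (t : ℝ) ≤ s := by exact_mod_cast ht.le
      rcases hT with hT | hT
      · refine (sum_abs_prod_sub_prod_le
          (p' := fun i => spiked b θ S ρ i + (n : ℝ)⁻¹ * (θ * bump b k r i)) hp0 hp1 ?_ ?_ t).trans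
          (le_trans ?_ hT)
        · exact fun i => (spiked_nonneg hθ hθ1 _ i).trans_eq (congrFun (hins r) i).symm
        · rw [hins]; exact sum_spiked hn _ (hρ' r hr)
        · simp only [add_sub_cancel_left]
          exact mul_le_mul hts (hνK r hr) (Finset.sum_nonneg fun i _ => abs_nonneg _)
            (Nat.cast_nonneg _)
      · refine (sum_abs_prod_spiked_le hn hθ hθ1 (hb k).2 hk hρ (mem_block.1 hr) t).trans
          (le_trans ?_ hT)
        exact mul_le_mul_of_nonneg_left
          (Real.sqrt_le_sqrt (mul_le_mul_of_nonneg_right hts (by positivity))) two_pos.le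
    have key := abs_sum_iidSum_add_sub_le hp0 hp1 (block b k)
      (fun r i => (n : ℝ)⁻¹ * (θ * bump b k r i))
      (fun i => by rw [← Finset.mul_sum, ← Finset.mul_sum, sum_bump_block, mul_zero, mul_zero])
      (fun r hr => by
        rw [← Finset.mul_sum, ← Finset.mul_sum, sum_bump (mem_block.1 hr), mul_zero, mul_zero])
      hL hνK hTV hf
    -- `key` bounds the average change over the points of the block, and some point does at least as
    -- well as the average.
    obtain ⟨r, hr, hle⟩ : ∃ r ∈ block b k, -(s * (L * (4 * θ / n) * T))
        ≤ iidSum (fun i => spiked b θ S ρ i + (n : ℝ)⁻¹ * (θ * bump b k r i)) f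
          - iidSum (spiked b θ S ρ) f := by
      refine Finset.exists_le_of_sum_le (hne k) ?_
      rw [Finset.sum_const, nsmul_eq_mul, mul_neg]
      exact (abs_le.1 key).1
    refine ⟨Function.update ρ k r, hρ' r hr, ?_⟩
    rw [hins] at hle
    rw [Finset.card_insert_of_notMem hk]
    push_cast
    linarith

/-- The relative density minus one of the distribution in which every block is perturbed. -/
def tilt (b : Fin n → Fin m) (θ : ℝ) (ρ : Fin m → Fin n) (i : Fin n) : ℝ :=
  θ * ∑ k, bump b k (ρ k) i

/-! ### Second moment of the uniform mixture of spiked distributions. -/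

lemma sum_tilt (hρ : ∀ k, b (ρ k) = k) : ∑ i, tilt b θ ρ i = 0 := by
  simp only [tilt]
  rw [← Finset.mul_sum, Finset.sum_comm, Finset.sum_eq_zero fun k _ => sum_bump (hρ k), mul_zero]

lemma one_add_tilt_nonneg (hθ : 0 ≤ θ) (hθ1 : θ ≤ 1) (ρ : Fin m → Fin n) (i : Fin n) :
    0 ≤ 1 + tilt b θ ρ i := by
  have := neg_one_le_sum_bump (b := b) Finset.univ ρ i
  unfold tilt; nlinarith

/-- The correlation of two perturbations. -/
lemma sum_tilt_mul_tilt {ρ' : Fin m → Fin n} (hρ : ∀ k, b (ρ k) = k) (hρ' : ∀ k, b (ρ' k) = k) :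
    ∑ i, tilt b θ ρ i * tilt b θ ρ' i = θ ^ 2 * ∑ k, (block b k).card *
      ((if ρ k = ρ' k then ((block b k).card : ℝ) else 0) - 1) := by
  have : ∀ i, tilt b θ ρ i * tilt b θ ρ' i
      = θ ^ 2 * ∑ k, bump b k (ρ k) i * bump b k (ρ' k) i := by
    intro i
    rw [← sum_bump_mul_sum_bump]; unfold tilt; ring
  rw [Finset.sum_congr rfl fun i _ => this i, ← Finset.mul_sum, Finset.sum_comm]
  congr 1
  exact Finset.sum_congr rfl fun k _ => sum_bump_mul_bump (hρ k) (hρ' k)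

/-- Bounding `1 + x` by `exp x` makes the correlation factor over blocks. Raising to the power `s`
needs a nonnegative base, which holds because the base is the uniform mean of a product of two
densities. -/
lemma pow_one_add_sum_tilt_le (hn : 0 < n) (hθ : 0 ≤ θ) (hθ1 : θ ≤ 1) {ρ' : Fin m → Fin n}
    (hρ : ∀ k, b (ρ k) = k) (hρ' : ∀ k, b (ρ' k) = k) (s : ℕ) :
    (1 + ∑ i, (n : ℝ)⁻¹ * (tilt b θ ρ i * tilt b θ ρ' i)) ^ s
      ≤ ∏ k, Real.exp (s * θ ^ 2 / n * ((block b k).card *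
        ((if ρ k = ρ' k then ((block b k).card : ℝ) else 0) - 1))) := by
  have hn0 : (0 : ℝ) < n := by positivity
  have hnn : 0 ≤ 1 + ∑ i, (n : ℝ)⁻¹ * (tilt b θ ρ i * tilt b θ ρ' i) := by
    have : 1 + ∑ i, (n : ℝ)⁻¹ * (tilt b θ ρ i * tilt b θ ρ' i)
        = ∑ i, (n : ℝ)⁻¹ * ((1 + tilt b θ ρ i) * (1 + tilt b θ ρ' i)) := by
      have : ∀ i, (1 + tilt b θ ρ i) * (1 + tilt b θ ρ' i)
        = 1 + tilt b θ ρ i + tilt b θ ρ' i + tilt b θ ρ i * tilt b θ ρ' i := fun i => by ring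
      rw [← Finset.mul_sum, ← Finset.mul_sum, Finset.sum_congr rfl fun i _ => this i,
        Finset.sum_add_distrib, Finset.sum_add_distrib, Finset.sum_add_distrib, sum_tilt hρ,
        sum_tilt hρ']
      simp
      field_simp
    rw [this]
    exact Finset.sum_nonneg fun i _ => mul_nonneg (by positivity)
      (mul_nonneg (one_add_tilt_nonneg hθ hθ1 ρ i) (one_add_tilt_nonneg hθ hθ1 ρ' i))
  rw [← Real.exp_sum]
  have : ∑ k, s * θ ^ 2 / n * ((block b k).card *
        ((if ρ k = ρ' k then ((block b k).card : ℝ) else 0) - 1))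
      = s * ∑ i, (n : ℝ)⁻¹ * (tilt b θ ρ i * tilt b θ ρ' i) := by
    rw [← Finset.mul_sum, ← Finset.mul_sum, sum_tilt_mul_tilt hρ hρ']; field_simp
  rw [this, Real.exp_nat_mul]
  exact pow_le_pow_left₀ hnn (by
    linarith [Real.add_one_le_exp (∑ i, (n : ℝ)⁻¹ * (tilt b θ ρ i * tilt b θ ρ' i))]) s

/-- For a uniform point `r'` of the block, the exponent is `lam` times a centred variable bounded by
6. The linear term of `exp x ≤ 1 + x + x²` cancels, and `6² = 36` remains. -/
lemma sum_exp_block_le {lam : ℝ} (hlam : 0 ≤ lam) (hlam1 : 6 * lam ≤ 1)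
    (hb : (block b k).card ≤ 3) (hr : b r = k) :
    ∑ r' ∈ block b k, Real.exp (lam * ((block b k).card *
        ((if r = r' then ((block b k).card : ℝ) else 0) - 1)))
      ≤ (block b k).card * Real.exp (36 * lam ^ 2) := by
  have hc3 : ((block b k).card : ℝ) ≤ 3 := by exact_mod_cast hb
  have hc1 : (1 : ℝ) ≤ (block b k).card := by exact_mod_cast card_block_pos hr
  have hv0 : ∑ r' ∈ block b k, ((block b k).card *
      ((if r = r' then ((block b k).card : ℝ) else 0) - 1)) = 0 := by
    rw [← Finset.mul_sum, Finset.sum_sub_distrib, Finset.sum_ite_eq, if_pos (mem_block.2 hr)]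
    simp
  generalize hv : (fun r' => ((block b k).card : ℝ) *
    ((if r = r' then ((block b k).card : ℝ) else 0) - 1)) = v
  have hv6 : ∀ r, |v r| ≤ 6 := by
    intro r
    rw [← hv, abs_le]
    dsimp only
    split_ifs <;> constructor <;> nlinarith
  simp only [funext_iff] at hv
  simp only [hv] at hv0 ⊢
  calc _ ≤ ∑ r ∈ block b k, (1 + lam * v r + 36 * lam ^ 2) := by
        refine Finset.sum_le_sum fun r _ => ?_
        have habs : |lam * v r| ≤ 6 * lam := by
          rw [abs_mul, abs_of_nonneg hlam, mul_comm]
          exact mul_le_mul_of_nonneg_right (hv6 r) hlam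
        have h3 := (abs_le.1 (Real.abs_exp_sub_one_sub_id_le (habs.trans hlam1))).2
        have h4 : (lam * v r) ^ 2 ≤ (6 * lam) ^ 2 :=
          sq_le_sq' (abs_le.1 habs).1 (abs_le.1 habs).2
        linarith
    _ = (block b k).card * (1 + 36 * lam ^ 2) := by
        rw [Finset.sum_add_distrib, Finset.sum_add_distrib, ← Finset.mul_sum, hv0]
        simp only [Finset.sum_const, nsmul_eq_mul]
        ring
    _ ≤ _ := mul_le_mul_of_nonneg_left
        (by linarith [Real.add_one_le_exp (36 * lam ^ 2)]) (Nat.cast_nonneg _)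

/-- The points are independent across blocks, so the sum of products is the product of the block
sums. -/
lemma sum_pow_one_add_sum_tilt_le (hn : 0 < n) (hθ : 0 ≤ θ) (hθ1 : θ ≤ 1)
    (hb : ∀ k, (block b k).card ≤ 3) (hρ : ∀ k, b (ρ k) = k) {s : ℕ}
    (hs : 6 * (s * θ ^ 2 / n) ≤ 1) :
    ∑ ρ' ∈ Fintype.piFinset (block b), (1 + ∑ i, (n : ℝ)⁻¹ * (tilt b θ ρ i * tilt b θ ρ' i)) ^ s
      ≤ (Fintype.piFinset (block b)).card * Real.exp (36 * (s * θ ^ 2 / n) ^ 2 * m) := by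
  calc _ ≤ ∑ ρ' ∈ Fintype.piFinset (block b), ∏ k, Real.exp (s * θ ^ 2 / n * ((block b k).card *
        ((if ρ k = ρ' k then ((block b k).card : ℝ) else 0) - 1))) :=
        Finset.sum_le_sum fun ρ' hρ' => pow_one_add_sum_tilt_le hn hθ hθ1 hρ
          (fun k => mem_block.1 (Fintype.mem_piFinset.1 hρ' k)) s
    _ = ∏ k, ∑ r ∈ block b k, Real.exp (s * θ ^ 2 / n * ((block b k).card *
        ((if ρ k = r then ((block b k).card : ℝ) else 0) - 1))) :=
        (Finset.prod_univ_sum (block b) fun k r => Real.exp (s * θ ^ 2 / n * ((block b k).card *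
          ((if ρ k = r then ((block b k).card : ℝ) else 0) - 1)))).symm
    _ ≤ ∏ k, (((block b k).card : ℝ) * Real.exp (36 * (s * θ ^ 2 / n) ^ 2)) :=
        Finset.prod_le_prod (fun k _ => Finset.sum_nonneg fun r _ => (Real.exp_pos _).le)
          fun k _ => sum_exp_block_le (by positivity) hs (hb k) (hρ k)
    _ = _ := by
        rw [Finset.prod_mul_distrib, Finset.prod_const, ← Real.exp_nat_mul,
          Fintype.card_piFinset]
        push_cast
        rw [Finset.card_univ, Fintype.card_fin, mul_comm (m : ℝ)]

/-- Ingster's bound: the uniform distribution is not distinguished from all the spiked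
distributions. -/
lemma sq_le_of_forall_iidSum_spiked_le (hn : 0 < n) (hθ : 0 ≤ θ) (hθ1 : θ ≤ 1)
    (hb : ∀ k, 2 ≤ (block b k).card ∧ (block b k).card ≤ 3) {s : ℕ} {f : (Fin s → Fin n) → ℝ}
    (hf0 : ∀ X, 0 ≤ f X) (hf1 : ∀ X, f X ≤ 1) {δ : ℝ} (hδ : 0 ≤ δ)
    (h : ∀ ρ : Fin m → Fin n, (∀ k, b (ρ k) = k) →
      iidSum (spiked b θ Finset.univ ρ) f + δ ≤ iidSum (fun _ => (n : ℝ)⁻¹) f)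
    (hs : 6 * (s * θ ^ 2 / n) ≤ 1) :
    δ ^ 2 ≤ Real.exp (36 * (s * θ ^ 2 / n) ^ 2 * m) - 1 := by
  have hn0 : (0 : ℝ) < n := by positivity
  set P : Finset (Fin m → Fin n) := Fintype.piFinset (block b) with hP
  have hmem : ∀ ρ ∈ P, ∀ k, b (ρ k) = k := fun ρ hρ k =>
    mem_block.1 (Fintype.mem_piFinset.1 hρ k)
  have hPne : P.Nonempty := Fintype.piFinset_nonempty.2 fun k =>
    Finset.card_pos.1 (lt_of_lt_of_le two_pos (hb k).1)
  have hcard : (0 : ℝ) < P.card := by exact_mod_cast Finset.card_pos.2 hPne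
  set N : ℝ := (P.card : ℝ)⁻¹ with hN
  have hNc : N * P.card = 1 := inv_mul_cancel₀ hcard.ne'
  have hN0 : 0 < N := inv_pos.2 hcard
  have hq1 : ∑ _i : Fin n, (n : ℝ)⁻¹ = 1 := by simp [hn0.ne']
  have chi := sq_sum_abs_mixture_sub_le (p := fun _ : Fin n => (n : ℝ)⁻¹) (fun _ => by positivity)
    hq1 P hPne (tilt b θ) (fun ρ hρ => by rw [← Finset.mul_sum, sum_tilt (hmem ρ hρ), mul_zero]) s
  have hδle : δ ≤ ∑ X : Fin s → Fin n, |N * ∑ ρ ∈ P, ∏ j, ((n : ℝ)⁻¹ * (1 + tilt b θ ρ (X j)))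
      - ∏ j : Fin s, (n : ℝ)⁻¹| := by
    have h1 : N * ∑ ρ ∈ P, (iidSum (spiked b θ Finset.univ ρ) f + δ)
        ≤ iidSum (fun _ => (n : ℝ)⁻¹) f := by
      calc _ ≤ N * ∑ ρ ∈ P, iidSum (fun _ => (n : ℝ)⁻¹) f :=
            mul_le_mul_of_nonneg_left (Finset.sum_le_sum fun ρ hρ => h ρ (hmem ρ hρ)) hN0.le
        _ = _ := by rw [Finset.sum_const, nsmul_eq_mul, ← mul_assoc, hNc, one_mul]
    rw [Finset.sum_add_distrib, Finset.sum_const, nsmul_eq_mul, mul_add, ← mul_assoc, hNc,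
      one_mul] at h1
    have h2 : iidSum (fun _ => (n : ℝ)⁻¹) f - N * ∑ ρ ∈ P, iidSum (spiked b θ Finset.univ ρ) f
        = ∑ X : Fin s → Fin n, -((N * ∑ ρ ∈ P, ∏ j, ((n : ℝ)⁻¹ * (1 + tilt b θ ρ (X j)))
          - ∏ j : Fin s, (n : ℝ)⁻¹) * f X) := by
      simp only [iidSum, spiked, tilt]
      rw [Finset.sum_comm, Finset.mul_sum, ← Finset.sum_sub_distrib]
      refine Finset.sum_congr rfl fun X _ => ?_
      rw [← Finset.sum_mul]; ring
    refine (show δ ≤ _ by linarith).trans (h2.le.trans (Finset.sum_le_sum fun X _ => ?_))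
    refine (neg_le_abs _).trans ?_
    rw [abs_mul, abs_of_nonneg (hf0 X)]
    exact mul_le_of_le_one_right (abs_nonneg _) (hf1 X)
  refine (pow_le_pow_left₀ hδ hδle 2).trans (chi.trans (sub_le_sub_right ?_ 1))
  calc N ^ 2 * ∑ ρ ∈ P, ∑ ρ' ∈ P, (1 + ∑ i, (n : ℝ)⁻¹ * (tilt b θ ρ i * tilt b θ ρ' i)) ^ s
      ≤ N ^ 2 * ∑ ρ ∈ P, (P.card * Real.exp (36 * (s * θ ^ 2 / n) ^ 2 * m)) :=
        mul_le_mul_of_nonneg_left (Finset.sum_le_sum fun ρ hρ => sum_pow_one_add_sum_tilt_le hn hθ hθ1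
          (fun k => (hb k).2) (hmem ρ hρ) hs) (by positivity)
    _ = (N * P.card) ^ 2 * Real.exp (36 * (s * θ ^ 2 / n) ^ 2 * m) := by
        rw [Finset.sum_const, nsmul_eq_mul]; ring
    _ = _ := by rw [hNc]; ring

/-- `[n]` is partitioned into blocks of sizes 2 and 3. -/
lemma exists_block_card (hn : 2 ≤ n) :
    ∃ (m : ℕ) (b : Fin n → Fin m), ∀ k, 2 ≤ (block b k).card ∧ (block b k).card ≤ 3 := by
  -- Consecutive elements are paired; for odd `n` the `min` sends the leftover element to the last
  -- pair.
  refine ⟨n / 2, fun i => ⟨min (i / 2) (n / 2 - 1), by omega⟩, fun k => ?_⟩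
  have hk := k.2
  have hmem : ∀ i : Fin n, i ∈ block (fun i : Fin n =>
      (⟨min (i / 2) (n / 2 - 1), by omega⟩ : Fin (n / 2))) k ↔
      min ((i : ℕ) / 2) (n / 2 - 1) = k := by
    intro i; rw [mem_block, Fin.ext_iff]
  constructor
  · refine Finset.one_lt_card.2 ⟨⟨2 * k, by omega⟩, (hmem _).2 ?_, ⟨2 * k + 1, by omega⟩,
      (hmem _).2 ?_, ?_⟩
    · simp only; omega
    · simp only; omega
    · simp [Fin.ext_iff]
  · rw [← Finset.card_map Fin.valEmbedding]
    refine (Finset.card_le_card (t := {2 * (k : ℕ), 2 * (k : ℕ) + 1, 2 * (k : ℕ) + 2}) ?_).trans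
      Finset.card_le_three
    intro x hx
    obtain ⟨i, hi, rfl⟩ := Finset.mem_map.1 hx
    have := (hmem i).1 hi
    have := i.2
    simp only [Fin.valEmbedding_apply, Finset.mem_insert, Finset.mem_singleton]
    omega

end Blocks

/-! ### Lower bounds for testing uniformity by functions of bounded differences -/

section LowerBound

variable {n s : ℕ} {f : (Fin s → Fin n) → ℝ} {ε : ℝ}

/-- `f` is large on average under the uniform distribution and small under every distribution that
is `ε`-far from it. -/
structure Distinguishes (ε : ℝ) (f : (Fin s → Fin n) → ℝ) : Prop where
  nonneg : ∀ X, 0 ≤ f X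
  le_one : ∀ X, f X ≤ 1
  uniform_ge : 3 / 5 ≤ iidSum (fun _ => (n : ℝ)⁻¹) f
  far_le : ∀ p : Fin n → ℝ, (∀ i, 0 ≤ p i) → ∑ i, p i = 1 →
    ε < 1 / 2 * ∑ i, |p i - (n : ℝ)⁻¹| → iidSum p f ≤ 1 / 5

/-- The cap at 1 keeps the density nonnegative, and `ε < 1/2` makes `min 1 (4 * ε)` exceed `2 * ε`
strictly, so the total variation distance, at least half of it, exceeds `ε`. -/
lemma Distinguishes.spiked_le (h : Distinguishes ε f) (hn : 0 < n) (hε : 0 < ε) (hε2 : ε < 1 / 2)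
    {m : ℕ} {b : Fin n → Fin m} (hb : ∀ k, 2 ≤ (block b k).card ∧ (block b k).card ≤ 3)
    {ρ : Fin m → Fin n} (hρ : ∀ k, b (ρ k) = k) :
    iidSum (spiked b (min 1 (4 * ε)) Finset.univ ρ) f ≤ 1 / 5 := by
  have hθ : 0 ≤ min 1 (4 * ε) := le_min zero_le_one (by linarith)
  refine h.far_le _ (spiked_nonneg hθ (min_le_left _ _) _) (sum_spiked hn _ hρ) ?_
  have h1 := le_sum_abs_spiked_sub hn hθ hb hρ
  have h2 : 2 * ε < min 1 (4 * ε) := lt_min (by linarith) (by linarith)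
  linarith

lemma Distinguishes.sqrt_le (h : Distinguishes ε f) (hn : 2 ≤ n) (hε : 0 < ε) (hε2 : ε < 1 / 2) :
    √(n : ℝ) / ε ^ 2 ≤ 320 * s := by
  have hn0 : (0 : ℝ) < n := by exact_mod_cast (by omega : 0 < n)
  obtain ⟨m, b, hb⟩ := exists_block_card hn
  have hm := two_mul_le hb
  set θ := min 1 (4 * ε)
  have hθ : 0 ≤ θ := le_min zero_le_one (by linarith)
  have hθ4 : θ ≤ 4 * ε := min_le_right _ _
  by_contra hlt
  push Not at hlt
  rw [lt_div_iff₀ (by positivity)] at hlt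
  have hθ2 : θ ^ 2 ≤ 16 * ε ^ 2 := by nlinarith
  have hr1 : 1 ≤ √(n : ℝ) := Real.one_le_sqrt.2 (by exact_mod_cast (by omega : 1 ≤ n))
  have hr2 : √(n : ℝ) * √(n : ℝ) = n := Real.mul_self_sqrt hn0.le
  have h1 : s * θ ^ 2 / n * (20 * √(n : ℝ)) ≤ 1 := by
    rw [div_mul_eq_mul_div, div_le_one hn0]
    calc s * θ ^ 2 * (20 * √(n : ℝ)) ≤ s * (16 * ε ^ 2) * (20 * √(n : ℝ)) := by gcongr
      _ = 320 * s * ε ^ 2 * √(n : ℝ) := by ring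
      _ ≤ √(n : ℝ) * √(n : ℝ) := by gcongr
      _ = n := hr2
  set lam : ℝ := s * θ ^ 2 / n
  have hlam0 : 0 ≤ lam := by positivity
  have h2 : lam * 20 ≤ 1 := by nlinarith
  have h3 : lam ^ 2 * n ≤ 1 / 400 := by
    have : (lam * (20 * √(n : ℝ))) ^ 2 ≤ 1 := pow_le_one₀ (by positivity) h1
    rw [mul_pow, mul_pow, Real.sq_sqrt hn0.le] at this
    linarith
  -- The gap is `3/5 - 1/5 = 2/5`. With `x = 36 * lam ^ 2 * m ≤ 9/200`, the contradiction is `4/25 ≤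
  -- exp x - 1 ≤ x + x²`.
  have key := sq_le_of_forall_iidSum_spiked_le (by omega) hθ (min_le_left _ _) hb h.nonneg
    h.le_one (δ := 2 / 5) (by norm_num)
    (fun ρ hρ => by linarith [h.spiked_le (by omega) hε hε2 hb hρ, h.uniform_ge])
    (show 6 * lam ≤ 1 by linarith)
  have hx : 36 * lam ^ 2 * m ≤ 9 / 200 := by nlinarith [sq_nonneg lam]
  have hx0 : 0 ≤ 36 * lam ^ 2 * m := by positivity
  have h4 := (abs_le.1 (Real.abs_exp_sub_one_sub_id_le (x := 36 * lam ^ 2 * m)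
    (by rw [abs_of_nonneg hx0]; linarith))).2
  nlinarith

/-- The total loss of the greedy choice must cover the gap. There are at most `n/2` blocks, which
cancels the `1/n` in the size of each perturbation. -/
lemma Distinguishes.two_fifths_le (h : Distinguishes ε f) (hn : 2 ≤ n) (hε : 0 < ε)
    (hε2 : ε < 1 / 2) {L T : ℝ} (hL : 0 ≤ L) (hf : BoundedDiff L f) (hT0 : 0 ≤ T)
    (hT : s * (16 * ε / n) ≤ T ∨ 2 * √(s * (96 * ε ^ 2 / n)) ≤ T) :
    2 / 5 ≤ 8 * s * L * ε * T := by
  have hn0 : (0 : ℝ) < n := by exact_mod_cast (by omega : 0 < n)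
  obtain ⟨m, b, hb⟩ := exists_block_card hn
  have hm := two_mul_le hb
  set θ := min 1 (4 * ε)
  have hθ : 0 ≤ θ := le_min zero_le_one (by linarith)
  have hθ4 : θ ≤ 4 * ε := min_le_right _ _
  obtain ⟨ρ, hρ, h1⟩ := exists_iidSum_spiked_ge (T := T) (by omega) hθ (min_le_left _ _) hb hL hf
    (hT.imp (fun hT => le_trans (mul_le_mul_of_nonneg_left
      (div_le_div_of_nonneg_right (by linarith) hn0.le) (Nat.cast_nonneg _)) hT)
      (fun hT => le_trans (by gcongr 2 * √(s * (?_ / n)); nlinarith) hT)) Finset.univ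
  have h2 := h.spiked_le (by omega) hε hε2 hb hρ
  have h3 := h.uniform_ge
  rw [Finset.card_univ, Fintype.card_fin] at h1
  calc 2 / 5 ≤ m * (s * (L * (4 * θ / n) * T)) := by linarith
    _ ≤ (n / 2) * (s * (L * (4 * (4 * ε) / n) * T)) := by gcongr; linarith
    _ = _ := by field_simp; ring

lemma Distinguishes.two_fifths_le_linear (h : Distinguishes ε f) (hn : 2 ≤ n) (hε : 0 < ε)
    (hε2 : ε < 1 / 2) {L : ℝ} (hL : 0 ≤ L) (hf : BoundedDiff L f) :
    2 / 5 ≤ 8 * s * L * ε := by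
  have hn0 : (0 : ℝ) < n := by exact_mod_cast (by omega : 0 < n)
  obtain ⟨m, b, hb⟩ := exists_block_card hn
  have hθ : 0 ≤ min 1 (4 * ε) := le_min zero_le_one (by linarith)
  have hθ4 : min 1 (4 * ε) ≤ 4 * ε := min_le_right _ _
  have : ∀ k, ∃ i, b i = k := fun k => by
    obtain ⟨i, hi⟩ := Finset.card_pos.1 (lt_of_lt_of_le two_pos (hb k).1)
    exact ⟨i, mem_block.1 hi⟩
  choose ρ hρ using this
  have h1 := (abs_le.1 (abs_iidSum_sub_le (p := fun _ => (n : ℝ)⁻¹) (fun _ => by positivity)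
    (by simp [hn0.ne']) (spiked_nonneg hθ (min_le_left _ _) Finset.univ)
    (sum_spiked (by omega) _ hρ) hf)).1
  have h2 := h.spiked_le (by omega) hε hε2 hb hρ
  have h3 := h.uniform_ge
  have h4 := sum_abs_spiked_sub_le (by omega) hθ hρ
  calc 2 / 5 ≤ s * (L * ∑ i, |spiked b (min 1 (4 * ε)) Finset.univ ρ i - (n : ℝ)⁻¹|) := by
        linarith
    _ ≤ s * (L * (2 * (4 * ε))) := by gcongr; linarith
    _ = _ := by ring

/-- The number of samples needed by a distinguisher that is `(exp ξ - 1)`-Lipschitz. -/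
lemma Distinguishes.sampleBound_le (h : Distinguishes ε f) (hn : 2 ≤ n) (hε : 0 < ε)
    (hε2 : ε < 1 / 2) {ξ : ℝ} (hξ : 0 < ξ) (hf : BoundedDiff (Real.exp ξ - 1) f) :
    1 / 1280 * sampleBound n ε ξ ≤ s := by
  have hn0 : (0 : ℝ) < n := by exact_mod_cast (by omega : 0 < n)
  have hn1 : (1 : ℝ) ≤ n := by exact_mod_cast (by omega : 1 ≤ n)
  have hs0 : (0 : ℝ) ≤ s := Nat.cast_nonneg _
  have t1 := h.sqrt_le hn hε hε2
  have hA0 : 0 ≤ √(n : ℝ) / ε ^ 2 := by positivity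
  have hA2 : (√(n : ℝ) / ε ^ 2) ^ 2 = n / ε ^ 4 := by
    rw [div_pow, Real.sq_sqrt hn0.le]; ring
  have hr1 : 1 ≤ √(n : ℝ) := Real.one_le_sqrt.2 hn1
  have hA1 : 1 / ε ^ 2 ≤ √(n : ℝ) / ε ^ 2 := by gcongr
  have hε1 : 1 ≤ 1 / ε ^ 2 := by rw [le_div_iff₀ (by positivity)]; nlinarith
  set B := (n : ℝ) ^ (1 / 3 : ℝ) / (ε ^ (4 / 3 : ℝ) * ξ ^ (2 / 3 : ℝ)) with hB
  have hB3 : B ^ 3 = n / (ε ^ 4 * ξ ^ 2) := by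
    rw [hB, div_pow, mul_pow]
    simp only [← Real.rpow_natCast, ← Real.rpow_mul hn0.le, ← Real.rpow_mul hε.le,
      ← Real.rpow_mul hξ.le]
    norm_num
  have hC2 : (√(n : ℝ) / (ε * √ξ)) ^ 2 = n / (ε ^ 2 * ξ) := by
    rw [div_pow, mul_pow, Real.sq_sqrt hn0.le, Real.sq_sqrt hξ.le]
  have hmain : B ≤ 320 * s ∧ √(n : ℝ) / (ε * √ξ) ≤ 320 * s ∧ 1 / (ε * ξ) ≤ 320 * s := by
    -- For `ξ ≤ 1` the Lipschitz constant is at most `2 * ξ`. For `ξ > 1` the privacy terms are all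
    -- dominated by `√n/ε²`.
    rcases le_or_gt ξ 1 with hξ1 | hξ1
    · have hL0 : 0 ≤ Real.exp ξ - 1 := by linarith [Real.add_one_le_exp ξ]
      have hL2 : Real.exp ξ - 1 ≤ 2 * ξ := by
        have := (abs_le.1 (Real.abs_exp_sub_one_sub_id_le (x := ξ)
          (by rw [abs_of_pos hξ]; exact hξ1))).2
        nlinarith
      refine ⟨?_, ?_, ?_⟩
      -- The `χ²` value of `T`. Squaring removes the root and leaves `s³ε⁴ξ² ≳ n`, which is compared
      -- with `B ^ 3`.
      · have k := h.two_fifths_le hn hε hε2 hL0 hf (by positivity) (Or.inr le_rfl)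
        have k' : 2 / 5 ≤ 32 * s * ξ * ε * √(s * (96 * ε ^ 2 / n)) := by
          refine k.trans ?_
          calc _ ≤ 8 * s * (2 * ξ) * ε * (2 * √(s * (96 * ε ^ 2 / n))) := by gcongr
            _ = _ := by ring
        have k2 : (2 / 5 : ℝ) ^ 2 ≤ (32 * s * ξ * ε) ^ 2 * (s * (96 * ε ^ 2 / n)) := by
          rw [← Real.sq_sqrt (by positivity : (0 : ℝ) ≤ s * (96 * ε ^ 2 / n)), ← mul_pow]
          exact pow_le_pow_left₀ (by norm_num) k' 2
        refine le_of_pow_le_pow_left₀ three_ne_zero (by positivity) ?_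
        rw [hB3, div_le_iff₀ (by positivity)]
        have e : (32 * s * ξ * ε) ^ 2 * (s * (96 * ε ^ 2 / n))
          = 98304 * (s ^ 3 * (ε ^ 4 * ξ ^ 2)) / n := by ring
        rw [e, le_div_iff₀ hn0] at k2
        have : 0 ≤ (s : ℝ) ^ 3 * (ε ^ 4 * ξ ^ 2) := by positivity
        nlinarith
      -- The subadditive value of `T`, giving `s²ε²ξ ≳ n`.
      · have k := h.two_fifths_le hn hε hε2 hL0 hf (by positivity) (Or.inl le_rfl)
        have k' : 2 / 5 ≤ 256 * (s ^ 2 * (ε ^ 2 * ξ)) / n := by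
          refine k.trans ?_
          calc _ ≤ 8 * s * (2 * ξ) * ε * (s * (16 * ε / n)) := by gcongr
            _ = _ := by ring
        rw [le_div_iff₀ hn0] at k'
        refine le_of_pow_le_pow_left₀ two_ne_zero (by positivity) ?_
        rw [hC2, div_le_iff₀ (by positivity)]
        have : 0 ≤ (s : ℝ) ^ 2 * (ε ^ 2 * ξ) := by positivity
        nlinarith
      · have k := h.two_fifths_le_linear hn hε hε2 hL0 hf
        have k' : 2 / 5 ≤ 16 * (s * (ε * ξ)) := by
          refine k.trans ?_
          calc _ ≤ 8 * s * (2 * ξ) * ε := by gcongr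
            _ = _ := by ring
        rw [div_le_iff₀ (by positivity)]
        have : 0 ≤ (s : ℝ) * (ε * ξ) := by positivity
        linarith
    · have hξ2 : 1 ≤ ξ ^ 2 := by nlinarith
      refine ⟨le_trans ?_ t1, le_trans ?_ t1, le_trans ?_ t1⟩
      -- With `A = √n/ε² ≥ 1`, the chain is `B³ ≤ n/ε⁴ = A² ≤ A³`.
      · refine le_of_pow_le_pow_left₀ three_ne_zero hA0 ?_
        rw [hB3, pow_succ (√(n : ℝ) / ε ^ 2) 2, hA2]
        calc (n : ℝ) / (ε ^ 4 * ξ ^ 2) ≤ n / (ε ^ 4 * 1) := by gcongr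
          _ = n / ε ^ 4 * 1 := by ring
          _ ≤ _ := by gcongr; linarith
      · gcongr
        have : 1 ≤ √ξ := Real.one_le_sqrt.2 hξ1.le
        nlinarith
      · refine le_trans ?_ hA1
        gcongr
        nlinarith
  -- Each of the four terms is at most `320 * s`, and `4 * 320 = 1280`.
  unfold sampleBound
  linarith [hmain.1, hmain.2.1, hmain.2.2]

end LowerBound

/-! ### Testers -/

instance : Fintype AugAnswer :=
  ⟨⟨↑[AugAnswer.accept, AugAnswer.reject, AugAnswer.bot], by simp⟩, fun x => by cases x <;> simp⟩

instance : Fintype Answer :=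
  ⟨⟨↑[Answer.accept, Answer.reject], by simp⟩, fun x => by cases x <;> simp⟩

lemma AugAnswer.sum_eq {M : Type*} [AddCommMonoid M] (g : AugAnswer → M) :
    ∑ a, g a = g accept + (g reject + g bot) := by
  change (Multiset.map g ↑[accept, reject, bot]).sum = _
  simp

lemma Answer.sum_eq {M : Type*} [AddCommMonoid M] (g : Answer → M) :
    ∑ a, g a = g accept + g reject := by
  change (Multiset.map g ↑[accept, reject]).sum = _
  simp

lemma sum_toReal_eq_one {α : Type*} [Fintype α] (p : PMF α) : ∑ a, (p a).toReal = 1 := by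
  have h := p.tsum_coe
  rw [tsum_fintype] at h
  rw [← ENNReal.toReal_sum fun a _ => p.apply_ne_top a, h, ENNReal.toReal_one]

variable {n s : ℕ}

lemma sum_outputProb {R : Type} [Fintype R] (A : Algorithm n s R) (p : PMF (Fin n)) :
    ∑ r, outputProb A p r = 1 := by
  unfold outputProb
  rw [Finset.sum_comm]
  simp only [← Finset.mul_sum, sum_toReal_eq_one, mul_one]
  exact sum_prod_eq_one (sum_toReal_eq_one p)

lemma IsDP.apply_le {R : Type} {ξ : ℝ} {A : Algorithm n s R} (hA : IsDP ξ A)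
    {X X' : Fin s → Fin n} (h : hammingDist X X' = 1) (r : R) :
    (A X r).toReal ≤ Real.exp ξ * (A X' r).toReal := by
  have := hA X X' h {r}
  rwa [PMF.toOuterMeasure_apply_singleton, PMF.toOuterMeasure_apply_singleton] at this

lemma toReal_apply_le_one {α : Type*} (p : PMF α) (a : α) : (p a).toReal ≤ 1 :=
  ENNReal.toReal_le_of_le_ofReal zero_le_one (by simpa using p.coe_le_one a)

lemma hammingDist_update {X : Fin s → Fin n} {j : Fin s} {a : Fin n} (h : X j ≠ a) :
    hammingDist X (Function.update X j a) = 1 := by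
  rw [hammingDist, Finset.card_eq_one]
  refine ⟨j, ?_⟩
  ext i
  by_cases hi : i = j
  · subst hi; simp [h]
  · simp [hi]

/-- A multiplicative bound between probabilities becomes additive: `exp ξ * x - x ≤ exp ξ - 1` for
`x ≤ 1`. -/
lemma IsDP.boundedDiff {R : Type} {ξ : ℝ} (hξ : 0 ≤ ξ) {A : Algorithm n s R} (hA : IsDP ξ A)
    (r : R) : BoundedDiff (Real.exp ξ - 1) (fun X => (A X r).toReal) := by
  intro X j a
  have hL : 0 ≤ Real.exp ξ - 1 := by linarith [Real.add_one_le_exp ξ]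
  by_cases h : X j = a
  · subst h; simpa using hL
  · have h1 := hA.apply_le (hammingDist_update h) r
    have h2 := hA.apply_le ((hammingDist_comm _ _).trans (hammingDist_update h)) r
    have h3 := toReal_apply_le_one (A X) r
    have h4 := toReal_apply_le_one (A (Function.update X j a)) r
    dsimp only
    rw [abs_le]
    constructor <;> nlinarith

lemma IsDP.bind {R R' : Type} [Fintype R] {ξ : ℝ} {A : Algorithm n s R} (hA : IsDP ξ A)
    (g : R → PMF R') : IsDP ξ (fun X => (A X).bind g) := by
  intro X X' h O
  have e : ∀ X, (((A X).bind g).toOuterMeasure O).toReal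
      = ∑ r, (A X r).toReal * ((g r).toOuterMeasure O).toReal := by
    intro X
    rw [PMF.toOuterMeasure_bind_apply, tsum_fintype, ENNReal.toReal_sum]
    · simp only [ENNReal.toReal_mul]
    · intro r _
      refine ENNReal.mul_ne_top ((A X).apply_ne_top r) (ne_top_of_le_ne_top ENNReal.one_ne_top ?_)
      rw [← (g r).tsum_coe, PMF.toOuterMeasure_apply]
      exact ENNReal.tsum_le_tsum fun a => Set.indicator_le_self _ _ _
  rw [e, e, Finset.mul_sum]
  refine Finset.sum_le_sum fun r _ => ?_
  rw [← mul_assoc]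
  exact mul_le_mul_of_nonneg_right (hA.apply_le h r) ENNReal.toReal_nonneg

lemma outputProb_bind {R R' : Type} [Fintype R] (A : Algorithm n s R) (g : R → PMF R')
    (p : PMF (Fin n)) (r' : R') :
    outputProb (fun X => (A X).bind g) p r' = ∑ r, outputProb A p r * (g r r').toReal := by
  unfold outputProb
  simp only [Finset.sum_mul]
  rw [Finset.sum_comm]
  refine Finset.sum_congr rfl fun X _ => ?_
  rw [PMF.bind_apply, tsum_fintype, ENNReal.toReal_sum fun r _ =>
    ENNReal.mul_ne_top ((A X).apply_ne_top r) ((g r).apply_ne_top r'), Finset.mul_sum]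
  simp only [ENNReal.toReal_mul, mul_assoc]

/-- The answer `accept` with probability `1/6`, and `reject` otherwise. -/
def biasedAnswer : PMF Answer :=
  PMF.ofFintype (fun a => ENNReal.ofReal (match a with | .accept => 1 / 6 | .reject => 5 / 6)) (by
    rw [Answer.sum_eq, ← ENNReal.ofReal_add (by norm_num) (by norm_num)]
    norm_num)

/-- Keep `accept`, and answer at random otherwise. -/
def forgetBot : AugAnswer → PMF Answer
  | .accept => PMF.pure .accept
  | .reject => biasedAnswer
  | .bot => biasedAnswer

/-- The bias `1/6` equalizes the errors: `(2/5)(5/6) = 1/3` when `p = q`, and at most `1/5 +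
(4/5)(1/6) = 1/3` when `p` is far. -/
lemma IsPrivateAugmentedIdentityTester.isPrivateIdentityTester {ξ ε α : ℝ} {q phat : PMF (Fin n)}
    (hq : tvDist q phat < α) {A : Algorithm n s AugAnswer}
    (hA : IsPrivateAugmentedIdentityTester ξ ε α (1 / 5) q phat A) :
    IsPrivateIdentityTester ξ ε (1 / 3) q (fun X => (A X).bind forgetBot) := by
  have hacc : (biasedAnswer .accept).toReal = 1 / 6 := by
    simp [biasedAnswer, PMF.ofFintype_apply]
  have hrej : (biasedAnswer .reject).toReal = 5 / 6 := by
    simp only [biasedAnswer, PMF.ofFintype_apply]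
    rw [ENNReal.toReal_ofReal (by norm_num)]
  refine ⟨IsDP.bind hA.dp _, fun p hp => ?_, fun p hp => ?_⟩
  · rw [Set.mem_singleton_iff] at hp
    subst hp
    have h1 := hA.reject_le p rfl
    have h2 := hA.bot_le p hq.le
    rw [outputProb_bind, AugAnswer.sum_eq]
    simp only [forgetBot, hrej, PMF.pure_apply]
    simp
    linarith
  · have h1 := hA.accept_le p hp
    have h2 := sum_outputProb A p
    rw [AugAnswer.sum_eq] at h2
    rw [outputProb_bind, AugAnswer.sum_eq]
    simp only [forgetBot, hacc, PMF.pure_apply]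
    simp
    linarith

/-! ### From augmented uniformity testers to distinguishers. -/

lemma uniformOfFintype_toReal [NeZero n] (i : Fin n) :
    (PMF.uniformOfFintype (Fin n) i).toReal = (n : ℝ)⁻¹ := by
  simp [PMF.uniformOfFintype_apply]

/-- The uniform distribution is itself within `α` of `phat`, so under it `reject` and `bot` each
have probability at most `1/5`, which leaves `3/5` for `accept`. -/
lemma IsPrivateAugmentedIdentityTester.distinguishes [NeZero n] {ξ ε α : ℝ} {phat : PMF (Fin n)}
    (hq : tvDist (PMF.uniformOfFintype (Fin n)) phat < α) {A : Algorithm n s AugAnswer}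
    (hA : IsPrivateAugmentedIdentityTester ξ ε α (1 / 5) (PMF.uniformOfFintype (Fin n)) phat A) :
    Distinguishes ε (fun X => (A X AugAnswer.accept).toReal) where
  nonneg _ := ENNReal.toReal_nonneg
  le_one _ := toReal_apply_le_one _ _
  uniform_ge := by
    have h1 := hA.reject_le _ rfl
    have h2 := hA.bot_le _ hq.le
    have h3 := sum_outputProb A (PMF.uniformOfFintype (Fin n))
    rw [AugAnswer.sum_eq] at h3
    have h4 : outputProb A (PMF.uniformOfFintype (Fin n)) AugAnswer.accept
        = iidSum (fun _ => (n : ℝ)⁻¹) (fun X => (A X AugAnswer.accept).toReal) := by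
      simp only [outputProb, iidSum, uniformOfFintype_toReal]
    linarith
  far_le p hp hp1 hfar := by
    let P : PMF (Fin n) := PMF.ofFintype (fun i => ENNReal.ofReal (p i)) (by
      rw [← ENNReal.ofReal_sum_of_nonneg fun i _ => hp i, hp1, ENNReal.ofReal_one])
    have hP : ∀ i, (P i).toReal = p i := fun i => by
      simp only [P, PMF.ofFintype_apply, ENNReal.toReal_ofReal (hp i)]
    have := hA.accept_le P (by
      intro q hq
      rw [Set.mem_singleton_iff] at hq
      subst hq
      simpa only [tvDist, hP, uniformOfFintype_toReal] using hfar)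
    simpa only [outputProb, iidSum, hP] using this

end

end PrivateAugmentedTesting

open PrivateAugmentedTesting in
theorem mainTheorem3 :
    (∀ (n s : ℕ) (ε α ξ : ℝ), 0 < ε → ε < 1 / 2 → 0 ≤ α → α < 1 / 2 → 0 < ξ →
      ∀ q phat : PMF (Fin n), tvDist q phat < α →
        (∃ A : Algorithm n s AugAnswer,
          IsPrivateAugmentedIdentityTester ξ ε α (1 / 5) q phat A) →
        ∃ B : Algorithm n s Answer, IsPrivateIdentityTester ξ ε (1 / 3) q B) ∧
    (∃ c : ℝ, 0 < c ∧
      ∀ (n : ℕ) [NeZero n] (ε α ξ : ℝ), 2 ≤ n → 0 < ε → ε < 1 / 2 → 0 ≤ α → α < 1 / 2 → 0 < ξ →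
        ∀ phat : PMF (Fin n), tvDist (PMF.uniformOfFintype (Fin n)) phat < α →
          ∀ (s : ℕ) (A : Algorithm n s AugAnswer),
            IsPrivateAugmentedIdentityTester ξ ε α (1 / 5)
              (PMF.uniformOfFintype (Fin n)) phat A →
            c * sampleBound n ε ξ ≤ s) := by
  refine ⟨fun n s ε α ξ _ _ _ _ _ q phat hq ⟨A, hA⟩ => ⟨_, hA.isPrivateIdentityTester hq⟩,
    1 / 1280, by norm_num, ?_⟩
  intro n _ ε α ξ hn hε hε2 _ _ hξ phat hq s A hA
  exact (hA.distinguishes hq).sampleBound_le hn hε hε2 hξ (hA.dp.boundedDiff hξ.le _)
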